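/- A skew Dyck path of semilength $s$ is a path with $2s$ steps from $U=(1,1)$, $D=(1,-1)$, $L=(-1,-1)$ which starts at the origin, ends on the $x$-axis, never goes below the $x$-axis, and in which no $U$ is followed by an $L$ and no $L$ is followed by a $U$. For $k\ge 1$, a $k$-box path of size $n$ is a skew Dyck path of semilength $(k+2)n-1$ with exactly $n$ factors (contiguous subwords) $UD^kL$. For $k=0$, by convention, a $0$-box path of size $n$ is a word obtained from a Dyck path of semilength $n-1$ by replacing every $D$ by $ULD$ and appending $UL$. An ascent is a maximal nonempty run of consecutive $U$ steps; it is long if its length is at least $2$. Let $k\ge 0$, $n\ge 1$, $j\ge 1$ be integers, with $n\ge 2$ if $k=0$. Then the number of $k$-box paths of size $n$ with exactly $j$ long ascents is $$\frac1j\binom{(k+1)n-2}{j-1}\binom{n-1}{j-1}.$$ For $k=0$ and $n\ge 2$ this number is the Narayana number $N_{n-1,j}=\frac1{n-1}\binom{n-1}{j}\binom{n-1}{j-1}$, which is also the number of Dyck paths of semilength $n-1$ with exactly $j$ ascents. -/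

import Mathlib

/-- The steps of a skew Dyck path: up `(1,1)`, down `(1,-1)`, left `(-1,-1)`. -/
inductive Step where
  | U
  | D
  | L
deriving DecidableEq

/-- The number of occurrences of the word `f` as a factor (contiguous subword) of `w`. -/
def factorCount {α : Type*} [DecidableEq α] (f w : List α) : ℕ :=
  w.tails.countP (fun t => f.isPrefixOf t)

/-- Skew Dyck paths of semilength `s`, as words of length `2 * s`. -/
structure IsSkewDyckPath (s : ℕ) (w : List Step) : Prop where
  length_eq : w.length = 2 * s
  /-- an up step is never followed by a left step -/
  no_UL : ¬ [Step.U, Step.L] <:+: w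
  /-- a left step is never followed by an up step -/
  no_LU : ¬ [Step.L, Step.U] <:+: w
  /-- the path ends on the `x`-axis -/
  balanced : w.count Step.U = w.count Step.D + w.count Step.L
  /-- the path never goes below the `x`-axis -/
  nonneg : ∀ p, p <+: w → p.count Step.D + p.count Step.L ≤ p.count Step.U

/-- The word `U D^k L`. -/
def boxFactor (k : ℕ) : List Step :=
  Step.U :: (List.replicate k Step.D ++ [Step.L])

/-- The word obtained from a Dyck path by replacing every down step by `U L D` and appending
`U L` (this is not a skew Dyck path, as `U L` occurs in it). -/
def zeroBoxWord (d : DyckWord) : List Step :=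
  d.toList.flatMap (fun
    | DyckStep.U => [Step.U]
    | DyckStep.D => [Step.U, Step.L, Step.D]) ++ [Step.U, Step.L]

/-- `k`-box paths of size `n`. For `k ≥ 1`: skew Dyck paths of semilength `(k + 2) * n - 1` with
exactly `n` factors `U D^k L`. For `k = 0`, by convention: the words `zeroBoxWord d`
for the Dyck paths `d` of semilength `n - 1`. -/
def IsBoxPath : ℕ → ℕ → List Step → Prop
  | 0, n, w => ∃ d : DyckWord, d.semilength + 1 = n ∧ w = zeroBoxWord d
  | k + 1, n, w => ∃ s, s + 1 = (k + 1 + 2) * n ∧ IsSkewDyckPath s w ∧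
      factorCount (boxFactor (k + 1)) w = n

/-- The number of maximal runs of the letter `u` in `w` that have length at least `m`
(`List.splitBy` cuts `w` into its maximal constant runs). -/
def runCount {α : Type*} [DecidableEq α] (u : α) (m : ℕ) (w : List α) : ℕ :=
  (w.splitBy (fun a b => a == b)).countP (fun r => decide (u ∈ r ∧ m ≤ r.length))

/-- The number of long ascents: maximal runs of at least two up steps. -/
def longAscentCount (w : List Step) : ℕ :=
  runCount Step.U 2 w

/-- The number of ascents (maximal nonempty runs of up steps) of a Dyck path. -/
def dyckAscentCount (d : DyckWord) : ℕ :=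
  runCount DyckStep.U 1 d.toList

/-- The number of `k`-box paths of size `n` with exactly `j` long ascents. -/
noncomputable def boxPathCount (k n j : ℕ) : ℕ :=
  {w : List Step | IsBoxPath k n w ∧ longAscentCount w = j}.ncard

/-- The Narayana number `N_{m,j}` (for `m, j ≥ 1`). -/
def narayana (m j : ℕ) : ℚ :=
  1 / (m : ℚ) * (m.choose j : ℚ) * (m.choose (j - 1) : ℚ)

/-!
Box paths of size `n` and Dyck paths of semilength `n - 1` are both words
`u^(a₁+e) t d u^(a₂+e) t d ⋯ d u^(aₙ+e) t` (`blockWord`) over lists `a₁, …, aₙ` of natural numbers.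

For `k ≥ 1` this is a counting argument (`mul_factorCount_le`). A path of semilength `(k + 2) n - 1`
has that many letters `D` and `L`; its `n` factors `U D^k L` take up `(k + 1) n` of them, and as `L U`
is forbidden, two consecutive factors are separated by at least one more `D`, which needs `n - 1` of
them. So nothing else is left than letters `U`: the path is the word with `e = 1`, `t = D^k L` and
`d = D`. For `k = 0` the convention gives the same shape (`zeroBoxWord_eq_blockWord`), and a Dyck
word, cut at its `D`s, has it with `e = 0` and empty `t`.

In such a word the heights are smallest at the ends of the blocks. Hence the word is a path that
does not go below the axis exactly if `a₁ + ⋯ + aᵢ ≥ (k + 1) i` for `i < n`, while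
`a₁ + ⋯ + aₙ = (k + 1) n - 1` (`IsLukasiewicz`), and the ascents of length at least `e + 1`
correspond to the positive `aᵢ` (`runCount_blockWord`). By the cycle lemma
(`existsUnique_rotate_isLukasiewicz`) exactly one of the `n` rotations of a list with this sum has
the required partial sums. There are `n.choose j * ((k + 1) n - 2).choose (j - 1)` lists with this
sum and `j` positive entries (`card_listsWithPositives`), and division by `n` gives the formula.
-/

/-! ### Lists with a given number of positive entries -/

/-- The lists of `n` natural numbers with sum `M` and exactly `j` positive entries, generated by
their first entry, which is either `0` or `M - y`, where `y < M` is the sum of the rest. -/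
def listsWithPositives : ℕ → ℕ → ℕ → Finset (List ℕ)
  | 0, M, j => if M = 0 ∧ j = 0 then {[]} else ∅
  | n + 1, M, 0 => (listsWithPositives n M 0).image (List.cons 0)
  | n + 1, M, j + 1 => (listsWithPositives n M (j + 1)).image (List.cons 0) ∪
      (Finset.range M).biUnion fun y => (listsWithPositives n y j).image (List.cons (M - y))

theorem mem_listsWithPositives {n M j : ℕ} {a : List ℕ} :
    a ∈ listsWithPositives n M j ↔
      a.length = n ∧ a.sum = M ∧ a.countP (fun x => decide (0 < x)) = j := by
  induction n generalizing M j a with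
  | zero =>
    rw [listsWithPositives]
    split_ifs with h
    · simp only [Finset.mem_singleton, List.length_eq_zero_iff]
      constructor
      · rintro rfl; simp [h]
      · exact fun h => h.1
    · simp only [Finset.notMem_empty, List.length_eq_zero_iff, false_iff]
      rintro ⟨rfl, h1, h2⟩
      exact h ⟨by simpa using h1.symm, by simpa using h2.symm⟩
  | succ n ih =>
    rcases j with _ | j
    · simp only [listsWithPositives, Finset.mem_image, ih]
      constructor
      · rintro ⟨b, ⟨h1, h2, h3⟩, rfl⟩
        simp [h1, h2, h3]
      · rcases a with _ | ⟨x, b⟩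
        · simp
        · rintro ⟨h1, h2, h3⟩
          simp only [List.length_cons, List.sum_cons, List.countP_cons,
            decide_eq_true_eq] at h1 h2 h3
          split_ifs at h3 with hx
          have hx : x = 0 := by omega
          subst hx
          exact ⟨b, ⟨by omega, by omega, by omega⟩, rfl⟩
    · simp only [listsWithPositives, Finset.mem_union, Finset.mem_image, Finset.mem_biUnion,
        Finset.mem_range, ih]
      constructor
      · rintro (⟨b, ⟨h1, h2, h3⟩, rfl⟩ | ⟨y, hy, b, ⟨h1, h2, h3⟩, rfl⟩)
        · simp [h1, h2, h3]
        · have : 0 < M - y := by omega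
          simp only [List.length_cons, List.sum_cons, List.countP_cons, decide_eq_true_eq, this,
            if_true]
          omega
      · rcases a with _ | ⟨x, b⟩
        · simp
        · rintro ⟨h1, h2, h3⟩
          simp only [List.length_cons, List.sum_cons, List.countP_cons,
            decide_eq_true_eq] at h1 h2 h3
          split_ifs at h3 with hx
          · exact Or.inr ⟨b.sum, by omega, b, ⟨by omega, rfl, by omega⟩, by congr 1; omega⟩
          · have hx : x = 0 := by omega
            subst hx
            exact Or.inl ⟨b, ⟨by omega, by omega, by omega⟩, rfl⟩

/-- The number of compositions of `M` into `j` positive parts. -/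
def compositionCount : ℕ → ℕ → ℕ
  | 0, M => if M = 0 then 1 else 0
  | _ + 1, 0 => 0
  | j + 1, M + 1 => M.choose j

theorem sum_range_compositionCount (j M : ℕ) :
    ∑ y ∈ Finset.range M, compositionCount j y = compositionCount (j + 1) M := by
  induction M with
  | zero => simp [compositionCount]
  | succ M ih =>
    rw [Finset.sum_range_succ, ih]
    rcases j with _ | j <;> rcases M with _ | M <;> simp [compositionCount]
    rw [Nat.choose_succ_succ, add_comm]

theorem card_listsWithPositives (n M j : ℕ) :
    (listsWithPositives n M j).card = n.choose j * compositionCount j M := by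
  induction n generalizing M j with
  | zero =>
    rcases j with _ | j
    · by_cases h : M = 0 <;> simp [listsWithPositives, compositionCount, h]
    · simp [listsWithPositives]
  | succ n ih =>
    rcases j with _ | j
    · rw [listsWithPositives, Finset.card_image_of_injective _ (List.cons_injective), ih]
      simp
    · rw [listsWithPositives, Finset.card_union_of_disjoint, Finset.card_biUnion,
        Finset.card_image_of_injective _ (List.cons_injective), ih]
      · simp_rw [Finset.card_image_of_injective _ (List.cons_injective), ih]
        rw [← Finset.mul_sum, sum_range_compositionCount, Nat.choose_succ_succ]
        ring
      · intro y hy z hz hyz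
        have hy' := Finset.mem_range.1 (Finset.mem_coe.1 hy)
        have hz' := Finset.mem_range.1 (Finset.mem_coe.1 hz)
        rw [Function.onFun, Finset.disjoint_left]
        simp only [Finset.mem_image, not_exists, not_and]
        rintro _ ⟨b, -, rfl⟩ c - h
        have := (List.cons_eq_cons.1 h).1
        omega
      · rw [Finset.disjoint_left]
        simp only [Finset.mem_image, Finset.mem_biUnion, Finset.mem_range, not_exists, not_and]
        rintro _ ⟨b, -, rfl⟩ y hy c - h
        have := (List.cons_eq_cons.1 h).1
        omega

/-! ### The cycle lemma -/

/-- A list `a₁, …, aₙ` whose partial sums `a₁ + ⋯ + aᵢ` are at least `c * i` for `i < n`, while the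
whole sum is `c * n - 1`: the steps `aᵢ - c` form a Łukasiewicz path, which first reaches `-1` at
its end. -/
def IsLukasiewicz (c : ℕ) (a : List ℕ) : Prop :=
  a.sum + 1 = c * a.length ∧ ∀ i < a.length, c * i ≤ (a.take i).sum

theorem IsLukasiewicz.ne_nil {c : ℕ} {a : List ℕ} (h : IsLukasiewicz c a) : a ≠ [] := by
  rintro rfl
  simpa using h.1

theorem sum_take_eq_sum_range (a : List ℕ) {r : ℕ} (hr : r ≤ a.length) :
    (a.take r).sum = ∑ l ∈ Finset.range r, a.getD l 0 := by
  induction r with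
  | zero => simp
  | succ r ih =>
    rw [Finset.sum_range_succ, ← ih (by omega), List.sum_take_succ _ _ (by omega),
      List.getD_eq_getElem]

theorem sum_take_rotate (a : List ℕ) (i : ℕ) {r : ℕ} (hr : r ≤ a.length) :
    ((a.rotate i).take r).sum = ∑ l ∈ Finset.range r, a.getD ((i + l) % a.length) 0 := by
  rw [sum_take_eq_sum_range _ (by simpa using hr)]
  refine Finset.sum_congr rfl fun l hl => ?_
  have hl' : l < a.length := by have := Finset.mem_range.1 hl; omega
  rw [List.getD_eq_getElem _ _ (by simpa using hl'), List.getElem_rotate,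
    List.getD_eq_getElem _ _ (Nat.mod_lt _ (by omega)), add_comm l i]

/-- The cycle lemma. The periodic path with steps `aᵢ - c` loses `1` in each period, and the
rotation by `i` is good exactly when the path does not fall below its height at time `i` during
the following `n - 1` steps. This holds when `i` is the first minimum within a period, and
at no other time. -/
theorem existsUnique_rotate_isLukasiewicz {c : ℕ} {a : List ℕ} (h : a.sum + 1 = c * a.length) :
    ∃! i, i < a.length ∧ IsLukasiewicz c (a.rotate i) := by
  set n := a.length with hn
  have hn0 : 0 < n := by
    rcases Nat.eq_zero_or_pos n with h0 | h0
    · simp [h0] at h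
    · exact h0
  let P : ℕ → ℤ := fun i => ∑ l ∈ Finset.range i, ((a.getD (l % n) 0 : ℕ) : ℤ) - c * i
  have hP (i r : ℕ) (hr : r ≤ n) : P (i + r) = P i + ((a.rotate i).take r).sum - c * r := by
    simp only [P]
    rw [sum_take_rotate a i hr, Finset.sum_range_add]
    push_cast
    ring
  have hper (i : ℕ) : P (i + n) = P i - 1 := by
    rw [hP i n le_rfl, List.take_of_length_le (by simp [hn]), (List.rotate_perm a i).sum_eq]
    have : (a.sum : ℤ) + 1 = c * n := by exact_mod_cast h
    linarith
  have hgood (i : ℕ) : IsLukasiewicz c (a.rotate i) ↔ ∀ r < n, P i ≤ P (i + r) := by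
    rw [IsLukasiewicz, (List.rotate_perm a i).sum_eq, List.length_rotate, ← hn]
    simp only [h, true_and]
    refine forall₂_congr fun r hr => ?_
    rw [hP i r hr.le]
    zify
    constructor <;> intro h <;> linarith
  simp only [hgood]
  obtain ⟨m, hm, hmin⟩ := Finset.exists_min_image (Finset.range n) P ⟨0, by simpa using hn0⟩
  have hex : ∃ i, i < n ∧ P i = P m := ⟨m, by simpa using hm, rfl⟩
  classical
  set i := Nat.find hex with hi
  obtain ⟨hin, hPi⟩ := Nat.find_spec hex
  have hfirst : ∀ l < i, P i < P l := by
    intro l hl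
    have h1 := hmin l (by simp; omega)
    have h2 : P l ≠ P m := fun h => Nat.find_min hex hl ⟨by omega, h⟩
    rw [hi, hPi]
    omega
  have higood : ∀ r < n, P i ≤ P (i + r) := by
    intro r hr
    rcases lt_or_ge (i + r) n with h1 | h1
    · rw [hi, hPi]
      exact hmin _ (by simpa using h1)
    · have h2 := hfirst (i + r - n) (by omega)
      have h3 := hper (i + r - n)
      rw [Nat.sub_add_cancel h1] at h3
      omega
  -- two good times `p < q` within a period contradict `P (p + n) = P p - 1`
  have key (p q : ℕ) (hpq : p < q) (hq : q < n) (h1 : ∀ r < n, P p ≤ P (p + r))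
      (h2 : ∀ r < n, P q ≤ P (q + r)) : False := by
    have h3 := h1 (q - p) (by omega)
    have h4 := h2 (p + n - q) (by omega)
    rw [show p + (q - p) = q by omega] at h3
    rw [show q + (p + n - q) = p + n by omega, hper] at h4
    omega
  refine ⟨i, ⟨hin, higood⟩, ?_⟩
  rintro q ⟨hq, hqgood⟩
  rcases lt_trichotomy q i with h1 | h1 | h1
  · exact (key q i h1 hin hqgood higood).elim
  · exact h1
  · exact (key i q h1 hq higood hqgood).elim

/-- The Łukasiewicz lists of length `n` with exactly `j` positive entries; they encode both the box
paths with `j` long ascents and, for `c = 1`, the Dyck paths with `j` ascents. -/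
def lukasiewiczLists (c n j : ℕ) : Set (List ℕ) :=
  {a | IsLukasiewicz c a ∧ a.length = n ∧ a.countP (fun x => decide (0 < x)) = j}

/-- Each of the `n.choose j * (c * n - 2).choose (j - 1)` lists of length `n` with sum `c * n - 1`
and `j` positive entries has exactly one good rotation. -/
theorem mul_ncard_lukasiewiczLists {c n j : ℕ} (hcn : 2 ≤ c * n) (hj : 1 ≤ j) :
    n * (lukasiewiczLists c n j).ncard = n.choose j * (c * n - 2).choose (j - 1) := by
  classical
  set S := listsWithPositives n (c * n - 1) j with hS
  set G := S.filter (IsLukasiewicz c) with hG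
  have hset : lukasiewiczLists c n j = (G : Set (List ℕ)) := by
    ext a
    simp only [lukasiewiczLists, Set.mem_ofPred_eq, hG, Finset.coe_filter, hS,
      mem_listsWithPositives]
    constructor
    · rintro ⟨h1, h2, h3⟩
      have := h1.1
      rw [h2] at this
      exact ⟨⟨h2, by omega, h3⟩, h1⟩
    · rintro ⟨⟨h1, h2, h3⟩, h4⟩
      exact ⟨h4, h1, h3⟩
  have hrot (a : List ℕ) (i : ℕ) : a.rotate i ∈ S ↔ a ∈ S := by
    rw [hS, mem_listsWithPositives, mem_listsWithPositives, List.length_rotate,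
      (List.rotate_perm a i).sum_eq, (List.rotate_perm a i).countP_eq]
  have hcount := Finset.sum_card_bipartiteAbove_eq_sum_card_bipartiteBelow (s := S)
    (t := Finset.range n) (fun a i => IsLukasiewicz c (a.rotate i))
  have hleft : ∀ a ∈ S, (Finset.bipartiteAbove (fun a i => IsLukasiewicz c (a.rotate i))
      (Finset.range n) a).card = 1 := by
    intro a ha
    rw [hS, mem_listsWithPositives] at ha
    obtain ⟨i, hi, huniq⟩ := existsUnique_rotate_isLukasiewicz (c := c) (a := a)
      (by rw [ha.1, ha.2.1]; omega)
    rw [Finset.card_eq_one]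
    refine ⟨i, ?_⟩
    ext l
    simp only [Finset.mem_bipartiteAbove, Finset.mem_range, Finset.mem_singleton, ← ha.1]
    exact ⟨fun h => huniq l h, fun h => h ▸ hi⟩
  have hright : ∀ i ∈ Finset.range n, (Finset.bipartiteBelow
      (fun a i => IsLukasiewicz c (a.rotate i)) S i).card = G.card := by
    intro i _
    refine Finset.card_bij (fun a _ => a.rotate i) ?_ ?_ ?_
    · intro a ha
      rw [Finset.mem_bipartiteBelow] at ha
      exact Finset.mem_filter.2 ⟨(hrot a i).2 ha.1, ha.2⟩
    · intro a _ b _ h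
      exact List.rotate_injective i h
    · intro b hb
      obtain ⟨a, rfl⟩ : ∃ a : List ℕ, a.rotate i = b := ⟨_, List.rotate_eq_iff.2 rfl⟩
      rw [hG, Finset.mem_filter, hrot] at hb
      exact ⟨a, (Finset.mem_bipartiteBelow _).2 hb, rfl⟩
  rw [Finset.sum_congr rfl hleft, Finset.sum_congr rfl hright] at hcount
  simp only [Finset.sum_const, smul_eq_mul, mul_one, Finset.card_range] at hcount
  rw [hset, Set.ncard_coe_finset, ← hcount, hS, card_listsWithPositives]
  obtain ⟨j, rfl⟩ := Nat.exists_eq_add_of_le' hj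
  rw [show c * n - 1 = (c * n - 2) + 1 by omega]
  rfl

theorem ncard_lukasiewiczLists {c n j : ℕ} (hcn : 2 ≤ c * n) (hj : 1 ≤ j) :
    ((lukasiewiczLists c n j).ncard : ℚ) =
      1 / (j : ℚ) * ((c * n - 2).choose (j - 1) : ℚ) * ((n - 1).choose (j - 1) : ℚ) := by
  have h := mul_ncard_lukasiewiczLists hcn hj
  obtain ⟨n, rfl⟩ : ∃ m, n = m + 1 :=
    Nat.exists_eq_succ_of_ne_zero (by rintro rfl; simp at hcn)
  obtain ⟨j, rfl⟩ := Nat.exists_eq_add_of_le' hj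
  have h2 := Nat.add_one_mul_choose_eq n j
  simp only [Nat.add_sub_cancel] at h ⊢
  have hq : ((n + 1 : ℕ) : ℚ) * (lukasiewiczLists c (n + 1) (j + 1)).ncard =
      (n + 1).choose (j + 1) * (c * (n + 1) - 2).choose j := by exact_mod_cast h
  have hq2 : ((n + 1 : ℕ) : ℚ) * n.choose j = (n + 1).choose (j + 1) * ((j + 1 : ℕ) : ℚ) := by
    exact_mod_cast h2
  have hn : ((n + 1 : ℕ) : ℚ) ≠ 0 := by positivity
  have hj' : ((j + 1 : ℕ) : ℚ) ≠ 0 := by positivity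
  apply mul_left_cancel₀ hn
  rw [hq]
  field_simp
  linear_combination (-((c * (n + 1) - 2).choose j : ℚ)) * hq2

/-- The form in which the cycle lemma gives the Narayana numbers for `c = 1`. -/
theorem one_div_mul_choose_eq_narayana {m j : ℕ} (hm : 1 ≤ m) (hj : 1 ≤ j) :
    1 / (j : ℚ) * ((m - 1).choose (j - 1) : ℚ) * (m.choose (j - 1) : ℚ) = narayana m j := by
  obtain ⟨m, rfl⟩ := Nat.exists_eq_add_of_le' hm
  obtain ⟨j, rfl⟩ := Nat.exists_eq_add_of_le' hj
  have h2 := Nat.add_one_mul_choose_eq m j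
  have hq2 : ((m + 1 : ℕ) : ℚ) * m.choose j = (m + 1).choose (j + 1) * ((j + 1 : ℕ) : ℚ) := by
    exact_mod_cast h2
  have hm' : ((m + 1 : ℕ) : ℚ) ≠ 0 := by positivity
  have hj' : ((j + 1 : ℕ) : ℚ) ≠ 0 := by positivity
  simp only [Nat.add_sub_cancel, narayana]
  field_simp
  linear_combination ((m + 1).choose j : ℚ) * hq2

/-! ### Runs of a letter -/

section Runs

variable {α : Type*} [DecidableEq α] {u : α} {m : ℕ}

theorem runCount_nil : runCount u m [] = 0 := rfl

theorem runCount_append {l l' : List α} (h : ∀ x ∈ l.getLast?, ∀ y ∈ l'.head?, x ≠ y) :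
    runCount u m (l ++ l') = runCount u m l + runCount u m l' := by
  rw [runCount, List.splitBy_append (l := l) (m := l') (by simpa using h), List.countP_append]
  rfl

theorem runCount_eq_zero_of_notMem {l : List α} (h : u ∉ l) : runCount u m l = 0 := by
  rw [runCount, List.countP_eq_zero]
  intro r hr
  have : u ∉ r := fun hu => h (by
    rw [← List.flatten_splitBy (fun a b => a == b) l]
    exact List.mem_flatten.2 ⟨r, hr, hu⟩)
  simp [this]

theorem runCount_replicate_self (x : ℕ) :
    runCount u m (List.replicate x u) = if 0 < x ∧ m ≤ x then 1 else 0 := by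
  rcases Nat.eq_zero_or_pos x with rfl | hx
  · simp [runCount_nil]
  · rw [runCount, List.splitBy_of_isChain (by simpa using hx.ne')
      (by simp [List.isChain_replicate_of_rel])]
    by_cases h : m ≤ x <;> simp [hx, hx.ne', h]

theorem runCount_cons_of_ne {v : α} (hv : v ≠ u) (l : List α) :
    runCount u m (v :: l) = runCount u m l := by
  have key (b : ℕ) (l' : List α) (h : ∀ y ∈ l'.head?, v ≠ y) :
      runCount u m (List.replicate b v ++ l') = runCount u m l' := by
    rw [runCount_append, runCount_eq_zero_of_notMem, zero_add]
    · simp [hv.symm]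
    · intro x hx
      have : x = v := List.eq_of_mem_replicate (List.mem_of_getLast? hx)
      exact this ▸ h
  obtain ⟨b, l', rfl, h⟩ : ∃ b l', l = List.replicate b v ++ l' ∧ ∀ y ∈ l'.head?, v ≠ y := by
    induction l with
    | nil => exact ⟨0, [], by simp⟩
    | cons x l ih =>
      by_cases hx : v = x
      · obtain ⟨b, l', rfl, h⟩ := ih
        exact ⟨b + 1, l', by simp [hx, List.replicate_succ], h⟩
      · exact ⟨0, x :: l, by simp, by simpa using hx⟩
  rw [key b l' h, ← List.cons_append, ← List.replicate_succ, key (b + 1) l' h]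

theorem runCount_append_of_notMem {t : List α} (ht : u ∉ t) (l : List α) :
    runCount u m (t ++ l) = runCount u m l := by
  induction t with
  | nil => rfl
  | cons v t ih =>
    rw [List.mem_cons, not_or] at ht
    rw [List.cons_append, runCount_cons_of_ne (Ne.symm ht.1), ih ht.2]

theorem runCount_replicate_append (x : ℕ) {l : List α} (h : ∀ y ∈ l.head?, u ≠ y) :
    runCount u m (List.replicate x u ++ l) =
      (if 0 < x ∧ m ≤ x then 1 else 0) + runCount u m l := by
  rw [runCount_append, runCount_replicate_self]
  intro y hy
  have : y = u := List.eq_of_mem_replicate (List.mem_of_getLast? hy)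
  exact this ▸ h

end Runs

/-! ### Nonnegative paths -/

/-- The path that starts at height `h` and whose letters `x` change the height by `s x` does not
go below height `0`. -/
def StaysNonneg {α : Type*} (s : α → ℤ) (h : ℤ) (w : List α) : Prop :=
  ∀ p, p <+: w → 0 ≤ h + (p.map s).sum

section Paths

variable {α : Type*} {s : α → ℤ}

theorem staysNonneg_nil {h : ℤ} : StaysNonneg s h [] ↔ 0 ≤ h := by
  simp [StaysNonneg]

theorem StaysNonneg.nonneg {h : ℤ} {w : List α} (hw : StaysNonneg s h w) : 0 ≤ h := by
  simpa using hw [] List.nil_prefix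

theorem staysNonneg_cons {h : ℤ} {x : α} {w : List α} :
    StaysNonneg s h (x :: w) ↔ 0 ≤ h ∧ StaysNonneg s (h + s x) w := by
  simp only [StaysNonneg, List.prefix_cons_iff]
  constructor
  · intro H
    refine ⟨by simpa using H [] (Or.inl rfl), fun p hp => ?_⟩
    simpa [add_assoc] using H (x :: p) (Or.inr ⟨p, rfl, hp⟩)
  · rintro ⟨h0, H⟩ p (rfl | ⟨t, rfl, ht⟩)
    · simpa using h0
    · simpa [add_assoc] using H t ht

theorem staysNonneg_replicate_append {u : α} (hu : s u = 1) {h : ℤ} (hh : 0 ≤ h) (x : ℕ)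
    {w : List α} : StaysNonneg s h (List.replicate x u ++ w) ↔ StaysNonneg s (h + x) w := by
  induction x generalizing h with
  | zero => simp
  | succ x ih =>
    rw [List.replicate_succ, List.cons_append, staysNonneg_cons, hu, ih (by omega)]
    simp only [hh, true_and]
    push_cast
    rw [show h + 1 + (x : ℤ) = h + (x + 1) by ring]

theorem staysNonneg_append_of_neg {t : List α} (ht : ∀ x ∈ t, s x = -1) {h : ℤ} {w : List α} :
    StaysNonneg s h (t ++ w) ↔ StaysNonneg s (h - t.length) w := by
  induction t generalizing h with
  | nil => simp
  | cons x t ih =>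
    rw [List.cons_append, staysNonneg_cons, ih (fun y hy => ht y (by simp [hy])),
      ht x (by simp), List.length_cons]
    push_cast
    rw [show h + -1 - (t.length : ℤ) = h - (t.length + 1) by ring]
    refine ⟨fun H => H.2, fun H => ⟨?_, H⟩⟩
    have := H.nonneg
    omega

end Paths

/-! ### Words of blocks -/

/-- The word `u^(a₁+e) t d u^(a₂+e) t d ⋯ d u^(aₙ+e) t`. Dyck words have this form with `e = 0`
and empty `t`, and `k`-box paths have it with `e = 1` and `t = D^k L`. -/
def blockWord {α : Type*} (u d : α) (e : ℕ) (t : List α) : List ℕ → List α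
  | [] => []
  | [x] => List.replicate (x + e) u ++ t
  | x :: y :: a => List.replicate (x + e) u ++ (t ++ d :: blockWord u d e t (y :: a))

section BlockWord

variable {α : Type*} {u d : α} {e : ℕ} {t : List α}

theorem blockWord_succ_cons (x : ℕ) (a : List ℕ) :
    blockWord u d e t ((x + 1) :: a) = u :: blockWord u d e t (x :: a) := by
  rcases a with _ | ⟨y, a⟩ <;>
    simp [blockWord, show x + 1 + e = (x + e) + 1 by ring, List.replicate_succ]

theorem blockWord_zero_cons {a : List ℕ} (ha : a ≠ []) :
    blockWord u d e t (0 :: a) = List.replicate e u ++ (t ++ d :: blockWord u d e t a) := by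
  obtain ⟨y, a, rfl⟩ := List.exists_cons_of_ne_nil ha
  simp [blockWord]

theorem head_ne_of_notMem {t l : List α} (ht : u ∉ t) (hl : ∀ y ∈ l.head?, u ≠ y) :
    ∀ y ∈ (t ++ l).head?, u ≠ y := by
  rcases t with _ | ⟨v, t⟩
  · exact hl
  · intro y hy
    simp only [List.cons_append, List.head?_cons, Option.mem_some] at hy
    rintro rfl
    exact ht (by simp [hy])

theorem replicate_append_inj {x y : ℕ} {l l' : List α} (hl : ∀ z ∈ l.head?, u ≠ z)
    (hl' : ∀ z ∈ l'.head?, u ≠ z)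
    (h : List.replicate x u ++ l = List.replicate y u ++ l') : x = y ∧ l = l' := by
  induction x generalizing y with
  | zero =>
    rcases y with _ | y
    · exact ⟨rfl, by simpa using h⟩
    · have : l = u :: (List.replicate y u ++ l') := by simpa [List.replicate_succ] using h
      exact (hl u (by simp [this]) rfl).elim
  | succ x ih =>
    rcases y with _ | y
    · have : l' = u :: (List.replicate x u ++ l) := by simpa [List.replicate_succ] using h.symm
      exact (hl' u (by simp [this]) rfl).elim
    · have := ih (y := y) (by simpa [List.replicate_succ] using h)
      exact ⟨by rw [this.1], this.2⟩

/-- The list `a` can be read off from `blockWord u d e t a`. -/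
theorem blockWord_injOn (hd : d ≠ u) (ht : u ∉ t) :
    Set.InjOn (blockWord u d e t) {a | a ≠ []} := by
  have h0 : ∀ z ∈ t.head?, u ≠ z := by simpa using head_ne_of_notMem (l := []) ht (by simp)
  have h1 (l : List α) : ∀ z ∈ (t ++ d :: l).head?, u ≠ z :=
    head_ne_of_notMem ht (by simpa using hd.symm)
  intro a
  induction a with
  | nil => simp
  | cons x a ih =>
    rintro - b hb hab
    obtain ⟨y, b, rfl⟩ := List.exists_cons_of_ne_nil hb
    rcases a with _ | ⟨x', a⟩ <;> rcases b with _ | ⟨y', b⟩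
    · have := (replicate_append_inj h0 h0 hab).1
      simp only [List.cons.injEq, and_true]
      omega
    · simpa using (replicate_append_inj h0 (h1 _) hab).2
    · simpa using (replicate_append_inj (h1 _) h0 hab).2
    · obtain ⟨h2, h3⟩ := replicate_append_inj (h1 _) (h1 _) hab
      have h4 := ih (by simp) (by simp : y' :: b ≠ []) (by simpa using h3)
      rw [h4, Nat.add_right_cancel h2]

theorem length_blockWord {a : List ℕ} (ha : a ≠ []) :
    (blockWord u d e t a).length + 1 = a.sum + (e + t.length + 1) * a.length := by
  induction a with
  | nil => exact (ha rfl).elim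
  | cons x a ih =>
    rcases a with _ | ⟨y, a⟩
    · simp [blockWord]
      ring
    · have := ih (by simp)
      simp only [blockWord, List.length_append, List.length_replicate, List.length_cons,
        List.sum_cons] at this ⊢
      linarith

theorem count_blockWord [DecidableEq α] (hd : d ≠ u) (ht : u ∉ t) (a : List ℕ) :
    (blockWord u d e t a).count u = a.sum + e * a.length := by
  induction a with
  | nil => simp [blockWord]
  | cons x a ih =>
    rcases a with _ | ⟨y, a⟩
    · simp [blockWord, List.count_eq_zero_of_not_mem ht]
    · simp only [blockWord, List.count_append, List.count_replicate_self,
        List.count_eq_zero_of_not_mem ht, List.count_cons_of_ne hd, ih, List.sum_cons,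
        List.length_cons]
      ring

/-- The long runs of `u` are those that come from the positive entries of `a`. -/
theorem runCount_blockWord [DecidableEq α] (hd : d ≠ u) (ht : u ∉ t) (a : List ℕ) :
    runCount u (e + 1) (blockWord u d e t a) = a.countP (fun x => decide (0 < x)) := by
  have hif (x : ℕ) : (if 0 < x + e ∧ e + 1 ≤ x + e then 1 else 0) = if 0 < x then 1 else 0 :=
    if_congr (by omega) rfl rfl
  induction a with
  | nil => rfl
  | cons x a ih =>
    rcases a with _ | ⟨y, a⟩
    · rw [blockWord, runCount_replicate_append _
        (by simpa using head_ne_of_notMem (l := []) ht (by simp)),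
        runCount_eq_zero_of_notMem ht, hif]
      simp [List.countP_cons]
    · rw [blockWord, runCount_replicate_append _ (head_ne_of_notMem ht (by simpa using hd.symm)),
        runCount_append_of_notMem ht, runCount_cons_of_ne hd, ih, hif,
        List.countP_cons (a := x)]
      simp [add_comm]

/-- The minima of the height are at the ends of the blocks. -/
theorem staysNonneg_blockWord {s : α → ℤ} (hu : s u = 1) (hd : s d = -1)
    (ht : ∀ x ∈ t, s x = -1) {a : List ℕ} (ha : a ≠ []) {h : ℤ} (hh : 0 ≤ h) :
    StaysNonneg s h (blockWord u d e t a) ↔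
      (∀ i < a.length, 0 ≤ h + (a.take i).sum + (e - t.length - 1) * i) ∧
        0 ≤ h + a.sum + (e - t.length - 1) * a.length + 1 := by
  induction a generalizing h with
  | nil => exact (ha rfl).elim
  | cons x a ih =>
    rcases a with _ | ⟨y, a⟩
    · rw [blockWord, staysNonneg_replicate_append hu hh, ← List.append_nil t,
        staysNonneg_append_of_neg ht, staysNonneg_nil]
      simp [hh]
      constructor <;> intro <;> linarith
    · rw [blockWord, staysNonneg_replicate_append hu hh, staysNonneg_append_of_neg ht,
        staysNonneg_cons, hd]
      set c : ℤ := e - t.length - 1 with hc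
      have h1 : h + ((x + e : ℕ) : ℤ) - t.length + -1 = h + x + c := by
        push_cast; rw [hc]; ring
      rw [h1]
      constructor
      · rintro ⟨-, H⟩
        obtain ⟨H1, H2⟩ := (ih (by simp) H.nonneg).1 H
        refine ⟨?_, ?_⟩
        · rintro (_ | i) hi
          · simpa using hh
          · have := H1 i (by simpa using hi)
            simp only [List.take_succ_cons, List.sum_cons]
            push_cast at this ⊢
            linarith
        · rw [List.sum_cons, List.length_cons]
          push_cast at H2 ⊢
          linarith
      · rintro ⟨H1, H2⟩
        have h2 : 0 ≤ h + x + c := by simpa [add_assoc] using H1 1 (by simp)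
        refine ⟨by omega, (ih (by simp) h2).2 ⟨fun i hi => ?_, ?_⟩⟩
        · have := H1 (i + 1) (by simpa using hi)
          simp only [List.take_succ_cons, List.sum_cons] at this
          push_cast at this ⊢
          linarith
        · rw [List.sum_cons, List.length_cons] at H2
          push_cast at H2 ⊢
          linarith

/-- When the sum of `a` is the one that makes the word of blocks end at height `0`, this word is a
nonnegative path exactly if `a` is a Łukasiewicz list. -/
theorem isLukasiewicz_iff_staysNonneg_blockWord {s : α → ℤ} {c : ℕ} (hc : c + e = t.length + 1)
    (hu : s u = 1) (hd : s d = -1) (ht : ∀ x ∈ t, s x = -1) {a : List ℕ} (ha : a ≠ [])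
    (hsum : a.sum + 1 = c * a.length) :
    IsLukasiewicz c a ↔ StaysNonneg s 0 (blockWord u d e t a) := by
  rw [staysNonneg_blockWord hu hd ht ha le_rfl]
  have hc' : (e : ℤ) - t.length - 1 = -c := by omega
  rw [hc', IsLukasiewicz]
  have h1 : 0 ≤ 0 + (a.sum : ℤ) + -c * a.length + 1 := by
    have : (a.sum : ℤ) + 1 = c * a.length := by exact_mod_cast hsum
    linarith
  simp only [h1, hsum, true_and, and_true]
  refine forall₂_congr fun i _ => ?_
  zify
  constructor <;> intro <;> linarith

end BlockWord

theorem ncard_image_blockWord {α : Type*} {u d : α} {e : ℕ} {t : List α} (hd : d ≠ u)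
    (ht : u ∉ t) (c n j : ℕ) :
    (blockWord u d e t '' lukasiewiczLists c n j).ncard = (lukasiewiczLists c n j).ncard :=
  Set.InjOn.ncard_image ((blockWord_injOn hd ht).mono fun _ h => h.1.ne_nil)

/-! ### Dyck words -/

/-- The change of height along a step of a Dyck path. -/
def dyckWeight : DyckStep → ℤ
  | DyckStep.U => 1
  | DyckStep.D => -1

theorem sum_map_dyckWeight (p : List DyckStep) :
    (p.map dyckWeight).sum = (p.count DyckStep.U : ℤ) - p.count DyckStep.D := by
  induction p with
  | nil => rfl
  | cons x p ih => cases x <;> simp [dyckWeight, ih] <;> ring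

theorem staysNonneg_dyckWeight {w : List DyckStep} :
    StaysNonneg dyckWeight 0 w ↔
      ∀ i, (w.take i).count DyckStep.D ≤ (w.take i).count DyckStep.U := by
  have h (p : List DyckStep) :
      0 ≤ 0 + (p.map dyckWeight).sum ↔ p.count DyckStep.D ≤ p.count DyckStep.U := by
    rw [sum_map_dyckWeight]; omega
  simp only [StaysNonneg, h]
  exact ⟨fun H i => H _ (List.take_prefix i w), fun H p hp => by
    rw [List.prefix_iff_eq_take.1 hp]; exact H _⟩

theorem exists_eq_blockWord_dyckStep (w : List DyckStep) :
    ∃ a, a ≠ [] ∧ w = blockWord DyckStep.U DyckStep.D 0 [] a := by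
  induction w with
  | nil => exact ⟨[0], by simp, rfl⟩
  | cons x w ih =>
    obtain ⟨a, ha, rfl⟩ := ih
    cases x with
    | U =>
      obtain ⟨y, a, rfl⟩ := List.exists_cons_of_ne_nil ha
      exact ⟨(y + 1) :: a, by simp, (blockWord_succ_cons y a).symm⟩
    | D => exact ⟨0 :: a, by simp, by simp [blockWord_zero_cons ha]⟩

theorem length_dyckStep (w : List DyckStep) :
    w.length = w.count DyckStep.U + w.count DyckStep.D := by
  induction w with
  | nil => rfl
  | cons x w ih => cases x <;> simp [ih] <;> ring

/-- Dyck paths of semilength `n - 1` are the words `U^a₁ D ⋯ D U^aₙ` for the Łukasiewicz lists `a`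
with `c = 1`; the last entry of such a list is `0`. -/
theorem exists_dyckWord_iff {n : ℕ} {w : List DyckStep} :
    (∃ d : DyckWord, d.semilength + 1 = n ∧ d.toList = w) ↔
      ∃ a, IsLukasiewicz 1 a ∧ a.length = n ∧ blockWord DyckStep.U DyckStep.D 0 [] a = w := by
  have hiff {a : List ℕ} (ha : a ≠ []) (hsum : a.sum + 1 = 1 * a.length) :=
    isLukasiewicz_iff_staysNonneg_blockWord (s := dyckWeight) (u := DyckStep.U)
      (d := DyckStep.D) (e := 0) (t := []) (c := 1) rfl rfl rfl (by simp) ha hsum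
  constructor
  · rintro ⟨d, hn, rfl⟩
    obtain ⟨a, ha, hda⟩ := exists_eq_blockWord_dyckStep d.toList
    have h1 : _ + 1 = _ := length_blockWord (u := DyckStep.U) (d := DyckStep.D) (e := 0)
      (t := []) ha
    have h2 := count_blockWord (u := DyckStep.U) (d := DyckStep.D) (e := 0) (t := [])
      (by simp) (by simp) a
    have h3 := d.count_U_eq_count_D
    have h4 := length_dyckStep d.toList
    rw [DyckWord.semilength] at hn
    rw [← hda] at h1 h2
    simp only [List.length_nil, zero_add, zero_mul, one_mul, add_zero] at h1 h2
    refine ⟨a, (hiff ha (by omega)).2 ?_, by omega, hda.symm⟩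
    rw [← hda]
    exact staysNonneg_dyckWeight.2 d.count_D_le_count_U
  · rintro ⟨a, ha, hn, rfl⟩
    have h1 : _ + 1 = _ := length_blockWord (u := DyckStep.U) (d := DyckStep.D) (e := 0)
      (t := []) ha.ne_nil
    have h2 := count_blockWord (u := DyckStep.U) (d := DyckStep.D) (e := 0) (t := [])
      (by simp) (by simp) a
    have h4 := length_dyckStep (blockWord DyckStep.U DyckStep.D 0 [] a)
    have h5 := ha.1
    simp only [List.length_nil, zero_add, zero_mul, one_mul, add_zero] at h1 h2 h5
    refine ⟨⟨_, by omega, staysNonneg_dyckWeight.1 ((hiff ha.ne_nil ha.1).1 ha)⟩, ?_, rfl⟩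
    rw [DyckWord.semilength]
    dsimp only
    omega

theorem ncard_dyckWord_dyckAscentCount {n j : ℕ} (hn : 1 ≤ n) :
    {d : DyckWord | d.semilength = n - 1 ∧ dyckAscentCount d = j}.ncard =
      (lukasiewiczLists 1 n j).ncard := by
  rw [← ncard_image_blockWord (u := DyckStep.U) (d := DyckStep.D) (e := 0) (t := [])
      (by simp) (by simp) 1 n j,
    ← Set.ncard_image_of_injective _ (f := DyckWord.toList) (fun _ _ h => DyckWord.ext h)]
  congr 1
  ext w
  have hrun (a : List ℕ) := runCount_blockWord (u := DyckStep.U) (d := DyckStep.D) (e := 0)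
    (t := []) (by simp) (by simp) a
  constructor
  · rintro ⟨d, ⟨h1, h2⟩, rfl⟩
    obtain ⟨a, h3, h4, h5⟩ := exists_dyckWord_iff.1 ⟨d, rfl, rfl⟩
    refine ⟨a, ⟨h3, by omega, ?_⟩, h5⟩
    rw [← hrun, h5]
    exact h2
  · rintro ⟨a, ⟨h1, h2, h3⟩, rfl⟩
    obtain ⟨d, h4, h5⟩ := exists_dyckWord_iff.2 ⟨a, h1, h2, rfl⟩
    refine ⟨d, ⟨by omega, ?_⟩, h5⟩
    rw [dyckAscentCount, h5, ← h3]
    exact hrun a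

/-! ### Box paths for `k = 0` -/

theorem zeroBoxWord_eq_blockWord {d : DyckWord} {a : List ℕ} (ha : a ≠ [])
    (hd : d.toList = blockWord DyckStep.U DyckStep.D 0 [] a) :
    zeroBoxWord d = blockWord Step.U Step.D 1 [Step.L] a := by
  have hrep (f : DyckStep → List Step) (hf : f DyckStep.U = [Step.U]) (x : ℕ) :
      (List.replicate x DyckStep.U).flatMap f = List.replicate x Step.U := by
    induction x with
    | zero => rfl
    | succ x ih => simp [List.replicate_succ, hf, ih]
  rw [zeroBoxWord, hd]
  clear hd
  induction a with
  | nil => exact (ha rfl).elim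
  | cons x a ih =>
    rcases a with _ | ⟨y, a⟩
    · rw [blockWord, blockWord, List.append_nil, hrep _ rfl, add_zero,
        List.replicate_succ']
      simp
    · rw [blockWord, blockWord, ← ih (by simp), List.flatMap_append, hrep _ rfl,
        add_zero, List.replicate_succ']
      simp

theorem setOf_isBoxPath_zero {n j : ℕ} :
    {w | IsBoxPath 0 n w ∧ longAscentCount w = j} =
      blockWord Step.U Step.D 1 [Step.L] '' lukasiewiczLists 1 n j := by
  have hrun (a : List ℕ) := runCount_blockWord (u := Step.U) (d := Step.D) (e := 1)
    (t := [Step.L]) (by simp) (by simp) a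
  ext w
  constructor
  · rintro ⟨⟨d, h1, rfl⟩, h2⟩
    obtain ⟨a, h3, h4, h5⟩ := exists_dyckWord_iff.1 ⟨d, h1, rfl⟩
    have h6 := zeroBoxWord_eq_blockWord h3.ne_nil h5.symm
    refine ⟨a, ⟨h3, h4, ?_⟩, h6.symm⟩
    rw [← hrun, ← h6]
    exact h2
  · rintro ⟨a, ⟨h1, h2, h3⟩, rfl⟩
    obtain ⟨d, h4, h5⟩ := exists_dyckWord_iff.2 ⟨a, h1, h2, rfl⟩
    exact ⟨⟨d, h4, (zeroBoxWord_eq_blockWord h1.ne_nil h5).symm⟩, (hrun a).trans h3⟩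

/-! ### Factors of skew Dyck paths -/

section FactorCount

variable {α : Type*} [DecidableEq α] {u : α} {t : List α}

theorem factorCount_cons {f : List α} {x : α} {w : List α} :
    factorCount f (x :: w) = factorCount f w + if f <+: x :: w then 1 else 0 := by
  simp [factorCount, List.countP_cons]

theorem factorCount_append_of_notMem {v : List α} (hv : u ∉ v) (w : List α) :
    factorCount (u :: t) (v ++ w) = factorCount (u :: t) w := by
  induction v with
  | nil => rfl
  | cons x v ih =>
    rw [List.mem_cons, not_or] at hv
    rw [List.cons_append, factorCount_cons, if_neg, ih hv.2, add_zero]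
    simp [List.cons_prefix_cons, hv.1]

theorem factorCount_cons_append (ht : u ∉ t) (w : List α) :
    factorCount (u :: t) (u :: (t ++ w)) = factorCount (u :: t) w + 1 := by
  rw [factorCount_cons, if_pos ⟨w, by simp⟩, factorCount_append_of_notMem ht]

theorem factorCount_nil : factorCount (u :: t) [] = 0 := by
  simp [factorCount]

theorem factorCount_blockWord {d : α} (hd : d ≠ u) (ht : u ∉ t) (ht0 : t ≠ []) (a : List ℕ) :
    factorCount (u :: t) (blockWord u d 1 t a) = a.length := by
  have hrep (x : ℕ) (l : List α) :
      factorCount (u :: t) (List.replicate (x + 1) u ++ (t ++ l)) =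
        factorCount (u :: t) l + 1 := by
    induction x with
    | zero => simpa using factorCount_cons_append ht l
    | succ x ih =>
      rw [List.replicate_succ, List.cons_append, factorCount_cons, ih, if_neg, add_zero]
      obtain ⟨y, t, rfl⟩ := List.exists_cons_of_ne_nil ht0
      simp only [List.replicate_succ, List.cons_append, List.cons_prefix_cons]
      rintro ⟨-, rfl, -⟩
      simp at ht
  induction a with
  | nil => exact factorCount_nil
  | cons x a ih =>
    rcases a with _ | ⟨y, a⟩
    · have := hrep x []
      rw [List.append_nil] at this
      rw [blockWord, this, factorCount_nil]
      rfl
    · rw [blockWord, hrep, ← List.singleton_append (x := d),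
        factorCount_append_of_notMem (by simpa using hd.symm), ih]
      rfl

end FactorCount

/-- The part `D^k L` of the box factor `U D^k L`. -/
def boxTail (k : ℕ) : List Step := List.replicate k Step.D ++ [Step.L]

theorem U_notMem_boxTail (k : ℕ) : Step.U ∉ boxTail k := by simp [boxTail]

theorem length_boxTail (k : ℕ) : (boxTail k).length = k + 1 := by simp [boxTail]

/-- A word without `L U` that has `m` letters other than `U` has at most `(m + 1) / (k + 2)`
factors `U D^k L`: each of them has `k + 1` letters other than `U`, and at least one more such
letter separates it from the next. If `(m + 1) / (k + 2)` is attained exactly, then the separating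
letters are single `D`s, there are no letters but `U` outside the factors and the separators, and
the word ends with a factor. -/
theorem mul_factorCount_le {k : ℕ} {w : List Step} (hw : ¬ [Step.L, Step.U] <:+: w) :
    (k + 2) * factorCount (boxFactor k) w ≤ w.countP (fun x => decide (x ≠ Step.U)) + 1 ∧
      ((k + 2) * factorCount (boxFactor k) w = w.countP (fun x => decide (x ≠ Step.U)) + 1 →
        ∃ a, a ≠ [] ∧ w = blockWord Step.U Step.D 1 (boxTail k) a) := by
  have hbox : boxFactor k = Step.U :: boxTail k := rfl
  have htail : (boxTail k).countP (fun x => decide (x ≠ Step.U)) = k + 1 := by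
    rw [List.countP_eq_length.2, length_boxTail]
    intro x hx
    simpa using ne_of_mem_of_not_mem hx (U_notMem_boxTail k)
  induction hlen : w.length using Nat.strong_induction_on generalizing w with
  | _ N ih =>
  rcases w with _ | ⟨x, w⟩
  · simp [hbox, factorCount_nil]
  by_cases hpre : boxFactor k <+: x :: w
  · obtain ⟨r, hr⟩ := hpre
    rw [← hr, hbox, List.cons_append] at hw hlen ⊢
    rw [factorCount_cons_append (U_notMem_boxTail k), List.countP_cons, List.countP_append, htail]
    simp only [ne_eq, not_true_eq_false, decide_false, Bool.false_eq_true, if_false, add_zero]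
    have hskip (y : Step) (hy : y ≠ Step.U) (r : List Step) :
        factorCount (Step.U :: boxTail k) (y :: r) = factorCount (Step.U :: boxTail k) r := by
      simpa using factorCount_append_of_notMem (u := Step.U) (t := boxTail k) (v := [y])
        (by simpa using hy.symm) r
    rcases r with _ | ⟨y, r⟩
    · rw [factorCount_nil]
      refine ⟨by simp, fun _ => ⟨[0], by simp, by simp [blockWord]⟩⟩
    · have hr' : ¬ [Step.L, Step.U] <:+: r := fun h => hw (h.trans
        ⟨Step.U :: (boxTail k ++ [y]), [], by simp⟩)
      obtain ⟨h1, h2⟩ := ih r.length (by simp at hlen; omega) hr' rfl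
      rw [hbox] at h1 h2
      cases y with
      | U => exact (hw ⟨Step.U :: List.replicate k Step.D, r, by simp [boxTail]⟩).elim
      | D =>
        rw [hskip _ (by simp)]
        simp only [ne_eq, List.countP_cons, reduceCtorEq, not_false_eq_true, decide_true,
          if_true] at h1 h2 ⊢
        refine ⟨by linarith, fun h => ?_⟩
        obtain ⟨a, ha, rfl⟩ := h2 (by linarith)
        refine ⟨0 :: a, by simp, ?_⟩
        rw [blockWord_zero_cons ha]
        simp
      | L =>
        rw [hskip _ (by simp)]
        simp only [ne_eq, List.countP_cons, reduceCtorEq, not_false_eq_true, decide_true,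
          if_true] at h1 h2 ⊢
        refine ⟨by linarith, fun h => ?_⟩
        -- `r` would start with `U`, right after an `L`
        obtain ⟨a, ha, rfl⟩ := h2 (by linarith)
        obtain ⟨z, a, rfl⟩ := List.exists_cons_of_ne_nil ha
        refine (hw ⟨Step.U :: boxTail k, (blockWord Step.U Step.D 1 (boxTail k) (z :: a)).tail,
          ?_⟩).elim
        rcases a with _ | ⟨z', a⟩ <;> simp [blockWord, List.replicate_succ]
  · rw [factorCount_cons, if_neg hpre, List.countP_cons, add_zero]
    obtain ⟨h1, h2⟩ := ih w.length (by simp at hlen; omega)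
      (fun h => hw (h.trans (List.suffix_cons x w).isInfix)) rfl
    by_cases hx : x = Step.U
    · subst hx
      simp only [ne_eq, not_true_eq_false, decide_false, Bool.false_eq_true, if_false,
        add_zero] at h1 h2 ⊢
      refine ⟨h1, fun h => ?_⟩
      obtain ⟨a, ha, rfl⟩ := h2 h
      obtain ⟨y, a, rfl⟩ := List.exists_cons_of_ne_nil ha
      exact ⟨(y + 1) :: a, by simp, (blockWord_succ_cons y a).symm⟩
    · simp only [ne_eq, hx, not_false_eq_true, decide_true, if_true] at h1 h2 ⊢
      exact ⟨by omega, by omega⟩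

/-! ### Box paths for `k ≥ 1` -/

/-- The change of height along a step of a skew Dyck path. -/
def stepWeight : Step → ℤ
  | Step.U => 1
  | Step.D => -1
  | Step.L => -1

theorem sum_map_stepWeight (p : List Step) :
    (p.map stepWeight).sum = (p.count Step.U : ℤ) - (p.count Step.D + p.count Step.L) := by
  induction p with
  | nil => rfl
  | cons x p ih => cases x <;> simp [stepWeight, ih] <;> ring

theorem staysNonneg_stepWeight {w : List Step} :
    StaysNonneg stepWeight 0 w ↔
      ∀ p, p <+: w → p.count Step.D + p.count Step.L ≤ p.count Step.U := by
  refine forall₂_congr fun p _ => ?_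
  rw [sum_map_stepWeight]
  omega

theorem isLukasiewicz_iff_staysNonneg_stepWeight {k : ℕ} {a : List ℕ} (ha : a ≠ [])
    (hsum : a.sum + 1 = (k + 1) * a.length) :
    IsLukasiewicz (k + 1) a ↔
      StaysNonneg stepWeight 0 (blockWord Step.U Step.D 1 (boxTail k) a) := by
  refine isLukasiewicz_iff_staysNonneg_blockWord (e := 1) (t := boxTail k)
    (by rw [length_boxTail]) rfl rfl ?_ ha hsum
  intro x hx
  cases x
  · exact (U_notMem_boxTail _ hx).elim
  · rfl
  · rfl

theorem length_step (w : List Step) :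
    w.length = w.count Step.U + w.count Step.D + w.count Step.L := by
  induction w with
  | nil => rfl
  | cons x w ih => cases x <;> simp [ih] <;> ring

theorem countP_ne_U (w : List Step) :
    w.countP (fun x => decide (x ≠ Step.U)) = w.count Step.D + w.count Step.L := by
  induction w with
  | nil => rfl
  | cons x w ih => rw [List.countP_cons, ih]; cases x <;> simp <;> ring

theorem isChain_blockWord_boxTail (k : ℕ) {a : List ℕ} (ha : a ≠ []) :
    ∃ v, blockWord Step.U Step.D 1 (boxTail (k + 1)) a = Step.U :: v ∧
      List.IsChain (fun x y => ¬ (x = Step.U ∧ y = Step.L) ∧ ¬ (x = Step.L ∧ y = Step.U))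
        (Step.U :: v) := by
  have hD (l : List Step) (hl : List.IsChain
      (fun x y => ¬ (x = Step.U ∧ y = Step.L) ∧ ¬ (x = Step.L ∧ y = Step.U)) (Step.L :: l)) :
      List.IsChain (fun x y => ¬ (x = Step.U ∧ y = Step.L) ∧ ¬ (x = Step.L ∧ y = Step.U))
        (Step.U :: (boxTail (k + 1) ++ l)) := by
    simp only [boxTail, List.replicate_succ, List.cons_append, List.append_assoc,
      List.isChain_cons_cons, reduceCtorEq, and_false, not_false_eq_true, and_self,
      true_and, List.nil_append]
    induction k with
    | zero => simpa using hl
    | succ k ih => simpa [List.replicate_succ] using ih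
  induction a with
  | nil => exact (ha rfl).elim
  | cons x a ih =>
    induction x with
    | zero =>
      rcases eq_or_ne a [] with rfl | ha'
      · exact ⟨boxTail (k + 1), by simp [blockWord], by simpa using hD [] (by simp)⟩
      · obtain ⟨v, h1, h2⟩ := ih ha'
        refine ⟨_, ?_, hD (Step.D :: Step.U :: v) (by simpa using h2)⟩
        rw [blockWord_zero_cons ha', h1]
        simp
    | succ x ihx =>
      obtain ⟨v, h1, h2⟩ := ihx (by simp)
      exact ⟨Step.U :: v, by rw [blockWord_succ_cons, h1], by simpa using h2⟩

theorem isSkewDyckPath_blockWord {k s : ℕ} {a : List ℕ} (ha : IsLukasiewicz (k + 2) a)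
    (hs : s + 1 = (k + 3) * a.length) :
    IsSkewDyckPath s (blockWord Step.U Step.D 1 (boxTail (k + 1)) a) := by
  have hnil := ha.ne_nil
  have h1 := length_blockWord (u := Step.U) (d := Step.D) (e := 1) (t := boxTail (k + 1)) hnil
  have h2 := count_blockWord (u := Step.U) (d := Step.D) (e := 1) (by simp)
    (U_notMem_boxTail (k + 1)) a
  have h3 := length_step (blockWord Step.U Step.D 1 (boxTail (k + 1)) a)
  have h4 := ha.1
  rw [length_boxTail] at h1
  obtain ⟨v, hv, hchain⟩ := isChain_blockWord_boxTail k hnil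
  rw [← hv] at hchain
  refine ⟨by linarith, fun h => ?_, fun h => ?_, by linarith,
    staysNonneg_stepWeight.1 ((isLukasiewicz_iff_staysNonneg_stepWeight hnil h4).1 ha)⟩
  · simpa using hchain.infix h
  · simpa using hchain.infix h

theorem setOf_isBoxPath_succ {k n j : ℕ} :
    {w | IsBoxPath (k + 1) n w ∧ longAscentCount w = j} =
      blockWord Step.U Step.D 1 (boxTail (k + 1)) '' lukasiewiczLists (k + 2) n j := by
  have hrun (a : List ℕ) := runCount_blockWord (u := Step.U) (d := Step.D) (e := 1)
    (by simp) (U_notMem_boxTail (k + 1)) a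
  have hfac (a : List ℕ) := factorCount_blockWord (u := Step.U) (d := Step.D) (by simp)
    (U_notMem_boxTail (k + 1)) (by simp [boxTail]) a
  ext w
  constructor
  · rintro ⟨⟨s, hs, hw, hn⟩, hj⟩
    have h1 := length_step w
    have h2 := hw.length_eq
    have h3 := hw.balanced
    have h4 := countP_ne_U w
    obtain ⟨a, ha, rfl⟩ := (mul_factorCount_le hw.no_LU).2 (by rw [hn, h4]; linarith)
    have h5 := count_blockWord (u := Step.U) (d := Step.D) (e := 1) (by simp)
      (U_notMem_boxTail (k + 1)) a
    have h6 : a.length = n := (hfac a).symm.trans hn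
    have hsum : a.sum + 1 = (k + 2) * a.length := by
      subst h6
      linarith
    refine ⟨a, ⟨?_, h6, (hrun a).symm.trans hj⟩, rfl⟩
    exact (isLukasiewicz_iff_staysNonneg_stepWeight ha hsum).2
      (staysNonneg_stepWeight.2 hw.nonneg)
  · rintro ⟨a, ⟨h1, rfl, h3⟩, rfl⟩
    have hpos : 0 < (k + 3) * a.length := by
      have := List.length_pos_iff.2 h1.ne_nil
      positivity
    have hs : (k + 3) * a.length - 1 + 1 = (k + 3) * a.length := by omega
    exact ⟨⟨_, hs, isSkewDyckPath_blockWord h1 hs, hfac a⟩, (hrun a).trans h3⟩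

theorem boxPathCount_eq (k n j : ℕ) :
    boxPathCount k n j = (lukasiewiczLists (k + 1) n j).ncard := by
  rcases k with _ | k
  · rw [boxPathCount, setOf_isBoxPath_zero, ncard_image_blockWord (by simp) (by simp)]
  · rw [boxPathCount, setOf_isBoxPath_succ,
      ncard_image_blockWord (by simp) (U_notMem_boxTail (k + 1))]

theorem theorem7p2 :
    (∀ k n j : ℕ, 1 ≤ n → (k = 0 → 2 ≤ n) → 1 ≤ j →
      (boxPathCount k n j : ℚ) =
        1 / (j : ℚ) * (((k + 1) * n - 2).choose (j - 1) : ℚ) * ((n - 1).choose (j - 1) : ℚ)) ∧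
    (∀ n j : ℕ, 2 ≤ n → 1 ≤ j →
      (boxPathCount 0 n j : ℚ) = narayana (n - 1) j ∧
      ({d : DyckWord | d.semilength = n - 1 ∧ dyckAscentCount d = j}.ncard : ℚ) =
        narayana (n - 1) j) := by
  refine ⟨fun k n j hn hk hj => ?_, fun n j hn hj => ?_⟩
  · rw [boxPathCount_eq]
    refine ncard_lukasiewiczLists ?_ hj
    rcases k with _ | k
    · simpa using hk rfl
    · nlinarith
  · rw [ncard_dyckWord_dyckAscentCount (by omega), boxPathCount_eq, zero_add, and_self,
      ncard_lukasiewiczLists (by omega) hj, one_mul,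
      ← one_div_mul_choose_eq_narayana (by omega) hj, Nat.sub_sub]
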